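/- Let $\Omega$ be a compact Hausdorff space (for example a compact metric space). A kernel is a continuous symmetric function $K:\Omega\times\Omega\to\mathbb R$. For a finite signed regular Borel measure $\nu$ on $\Omega$ put $$I_K(\nu)=\int_\Omega\int_\Omega K(x,y)\,d\nu(y)\,d\nu(x),$$ and call $K$ positive definite if $I_K(\nu)\ge 0$ for every such $\nu$. Let $K$ be a kernel and $C\in\mathbb R$ a constant such that $K+C$ is positive definite. Let $\mu$ be a regular Borel probability measure on $\Omega$ with $\operatorname{supp}(\mu)=\Omega$ which is $K$-invariant, i.e. $\int_\Omega K(x,y)\,d\mu(y)=I_K(\mu)$ for every $x\in\Omega$. Call a function $k:\Omega\times\Omega\to\mathbb R$ a convolution square root of $K+C$ if it is symmetric, measurable with respect to the product of the Borel $\sigma$-algebras, belongs to $L^2(\Omega\times\Omega,\mu\times\mu)$, and satisfies $$K(x,y)+C=\int_\Omega k(x,z)\,k(z,y)\,d\mu(z)\qquad\text{for all }x,y\in\Omega,$$ where all these integrals converge absolutely. Then a convolution square root of $K+C$ exists, and for every convolution square root $k$ of $K+C$ the following hold. (i) For every finite signed regular Borel measure $\nu$ with $\nu(\Omega)=1$,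 the squared $L^2$ discrepancy $$D^{2}_{L^2,k,\mu}(\nu)=\int_\Omega\Big|\int_\Omega k(x,y)\,d\nu(y)-\int_\Omega k(x,y)\,d\mu(y)\Big|^2d\mu(x)$$ is well defined and finite (for $\mu$-almost every $x$ the function $k(x,\cdot)$ is integrable with respect to $|\nu|$ and $\mu$, and the outer integrand is $\mu$-integrable), and $$I_K(\nu)-I_K(\mu)=D^{2}_{L^2,k,\mu}(\nu).$$ (ii) In particular, for every $N\ge 1$ and all points $z_1,\dots,z_N\in\Omega$ (not necessarily distinct), $$\frac1{N^2}\sum_{i,j=1}^N K(z_i,z_j)-I_K(\mu)=\int_\Omega\Big|\frac1N\sum_{i=1}^N k(x,z_i)-\int_\Omega k(x,y)\,d\mu(y)\Big|^2d\mu(x),$$ where the integrand on the right is $\mu$-integrable. -/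

import Mathlib

open MeasureTheory
open scoped ENNReal

namespace Stolarsky

noncomputable section

variable {Ω : Type*}

/-- A kernel on `Ω × Ω`: a continuous symmetric real function of two variables. -/
structure IsKernel [TopologicalSpace Ω] (K : Ω → Ω → ℝ) : Prop where
  continuous : Continuous (Function.uncurry K)
  symm : ∀ x y, K x y = K y x

/-- Regularity of a (finite) signed Borel measure: its total variation measure is regular.
On a compact metric space every signed Borel measure has this property. -/
def IsRegularSigned [TopologicalSpace Ω] [MeasurableSpace Ω] (ν : SignedMeasure Ω) : Prop :=
  ν.variation.Regular

/-- The `K`-energy `I_K(ν) = ∫ ∫ K(x, y) dν(y) dν(x)` of a signed measure. -/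
def energy [MeasurableSpace Ω] (K : Ω → Ω → ℝ) (ν : SignedMeasure Ω) : ℝ :=
  ∫ᵛ x, (∫ᵛ y, K x y ∂<•ν) ∂<•ν

/-- Positive definiteness: the energy of every finite regular signed Borel measure is nonnegative
(used for kernels `K`). -/
def IsPositiveDefinite [TopologicalSpace Ω] [MeasurableSpace Ω] (K : Ω → Ω → ℝ) : Prop :=
  ∀ ν : SignedMeasure Ω, IsRegularSigned ν → 0 ≤ energy K ν

/-- The potential `U_K^μ(x) = ∫ K(x, y) dμ(y)`. -/
def potential [MeasurableSpace Ω] (K : Ω → Ω → ℝ) (μ : Measure Ω) (x : Ω) : ℝ :=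
  ∫ y, K x y ∂μ

/-- `μ` is `K`-invariant: its potential is equal to `I_K(μ)` at every point. -/
def IsInvariantMeasure [MeasurableSpace Ω] (K : Ω → Ω → ℝ) (μ : Measure Ω) [IsFiniteMeasure μ] :
    Prop :=
  ∀ x, potential K μ x = energy K μ.toSignedMeasure

/-- `k` is a convolution square root of `L` with respect to `μ`: a symmetric measurable function
in `L²(μ × μ)` such that `L(x, y) = ∫ k(x, z) k(z, y) dμ(z)`, as a convergent integral,
for all `x` and `y`. -/
structure IsConvolutionSqrt [MeasurableSpace Ω] (μ : Measure Ω) (L k : Ω → Ω → ℝ) : Prop where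
  measurable : Measurable (Function.uncurry k)
  memLp : MemLp (Function.uncurry k) 2 (μ.prod μ)
  symm : ∀ x y, k x y = k y x
  integrable : ∀ x y, Integrable (fun z => k x z * k z y) μ
  eq_integral : ∀ x y, L x y = ∫ z, k x z * k z y ∂μ

/-- The local discrepancy `∫ k(x, y) dν(y) - ∫ k(x, y) dμ(y)` at `x`. -/
def localDiscrepancy [MeasurableSpace Ω] (k : Ω → Ω → ℝ) (μ : Measure Ω) (ν : SignedMeasure Ω)
    (x : Ω) : ℝ :=
  (∫ᵛ y, k x y ∂<•ν) - ∫ y, k x y ∂μ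

/-- The squared `L²` discrepancy of `ν` relative to `μ` with respect to `k`. -/
def l2DiscrepancySq [MeasurableSpace Ω] (k : Ω → Ω → ℝ) (μ : Measure Ω) (ν : SignedMeasure Ω) :
    ℝ :=
  ∫ x, |localDiscrepancy k μ ν x| ^ 2 ∂μ

/-- All integrals in the definition of the `L²` discrepancy of `ν` exist: the inner ones for
`μ`-almost every `x`, and then the outer one. -/
structure L2DiscrepancyWellDefined [MeasurableSpace Ω] (k : Ω → Ω → ℝ) (μ : Measure Ω)
    (ν : SignedMeasure Ω) : Prop where
  inner_signed : ∀ᵐ x ∂μ, ν.Integrable (fun y => k x y)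
  inner : ∀ᵐ x ∂μ, Integrable (fun y => k x y) μ
  outer : Integrable (fun x => |localDiscrepancy k μ ν x| ^ 2) μ

/-- The discrete energy `E_K = N⁻² ∑_{i, j} K(z_i, z_j)` of an `N`-point configuration. -/
def discreteEnergy (K : Ω → Ω → ℝ) {N : ℕ} (z : Fin N → Ω) : ℝ :=
  1 / (N : ℝ) ^ 2 * ∑ i, ∑ j, K (z i) (z j)

/-- The local discrepancy `N⁻¹ ∑_i k(x, z_i) - ∫ k(x, y) dμ(y)` of a configuration at `x`. -/
def discreteLocalDiscrepancy [MeasurableSpace Ω] (k : Ω → Ω → ℝ) (μ : Measure Ω) {N : ℕ}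
    (z : Fin N → Ω) (x : Ω) : ℝ :=
  1 / (N : ℝ) * ∑ i, k x (z i) - ∫ y, k x y ∂μ

/-- The squared `L²` discrepancy of a configuration relative to `μ` with respect to `k`. -/
def discreteL2DiscrepancySq [MeasurableSpace Ω] (k : Ω → Ω → ℝ) (μ : Measure Ω) {N : ℕ}
    (z : Fin N → Ω) : ℝ :=
  ∫ x, |discreteLocalDiscrepancy k μ z x| ^ 2 ∂μ

end

end Stolarsky

/-!
Write `L = K + C` and `T` for the integral operator of `L` on `L²(μ)`.

*The energy identity.* Let `k` be a convolution square root of `L`. For finite measures `α`, `β`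
put `u_α(z) = ∫ k(z, x) dα(x)`. Since `∫ k(z, x)² dμ(z) = L(x, x)` is bounded, Fubini's theorem
applies to `k(z, x) k(z, y)` on `μ × (α × β)` and gives `∫ u_α u_β dμ = ∫∫ L dβ dα`
(`IsConvolutionSqrt.integral_mul`). For `ν = α - β` of total mass one the discrepancy is
`∫ (u_α - u_β - u_μ)² dμ`. Expanding the square, the terms that contain `μ` are constants by
invariance, and the constant `C` cancels (`integral_sq_discrepancy`). For a signed measure `α` and
`β` come from the Jordan decomposition; for a configuration `α` is the counting measure divided by
`N`, and `β = 0`.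

*Existence of a convolution square root.* Two points need care: the convolution identity is required
for all `x` and `y` rather than almost all, and `Ω` need not be metrizable, so that `L²(μ)` need not
be separable. No spectral theorem is used. Testing positive definiteness on the measures
`s δ_x + f μ` gives `(T f)(x)² ≤ L(x, x) ⟪T f, f⟫` (`sq_pairing_sectionMap_le`). In particular `T` is
positive, and it has a self-adjoint square root `S` (`exists_isSelfAdjoint_mul_self_eq`). Now the
inequality says `‖T f‖_∞ ≤ c ‖S f‖`, so `T = B S` for a bounded operator `B` from `L²(μ)` to the
continuous functions (`exists_comp_eq_of_norm_le`), and `B g` is a continuous representative of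
`S g`. Let `w x` represent the functional `g ↦ (B g)(x)`. As `μ` has full support, continuous functions
that agree almost everywhere are equal, and this yields `⟪w x, w y⟫ = L(x, y)` for all `x`, `y`
(`exists_feature_map`); hence `w` is norm continuous. It remains to choose one symmetric and jointly
measurable function `k` such that `k(x, ·)` represents `w x` for every `x`
(`exists_symmetric_representative`): a jointly measurable representative exists since `w` is a
uniform limit of simple maps, it is symmetric almost everywhere since `S` is self-adjoint, and it can
be made symmetric by changing every row on a null set only.
-/

namespace Stolarsky

/-! ### Square roots of positive operators -/

/-- The Catalan generating function converges absolutely at its singularity `1 / 4`. The sum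
telescopes, because `catalan n / 4 ^ n = 2 * (b n - b (n + 1))` for `b n = centralBinom n / 4 ^ n`. -/
theorem summable_catalan_div_four_pow : Summable fun n : ℕ => (catalan n : ℝ) / 4 ^ n := by
  refine summable_of_sum_range_le (c := 2) (fun n => by positivity) fun N => ?_
  suffices h : ∑ n ∈ Finset.range N, (catalan n : ℝ) / 4 ^ n
      = 2 - 2 * (N.centralBinom / 4 ^ N) by
    rw [h]
    have : (0 : ℝ) ≤ N.centralBinom / 4 ^ N := by positivity
    linarith
  induction N with
  | zero => simp
  | succ N ih =>
    rw [Finset.sum_range_succ, ih]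
    have h₁ : ((N : ℝ) + 1) * (N + 1).centralBinom = 2 * (2 * N + 1) * N.centralBinom :=
      mod_cast Nat.succ_mul_centralBinom_succ N
    have h₂ : ((N : ℝ) + 1) * catalan N = N.centralBinom :=
      mod_cast succ_mul_catalan_eq_centralBinom N
    have h₃ : (N : ℝ) + 1 ≠ 0 := by positivity
    have h₄ : ((N + 1).centralBinom : ℝ) = 2 * (2 * N + 1) * catalan N := by
      apply mul_left_cancel₀ h₃
      rw [h₁, ← h₂]
      ring
    rw [h₄, ← h₂, pow_succ]
    field_simp
    ring

/-- In a real Banach algebra with a star operation, `1 - a` has a self-adjoint square root if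
`a` is self-adjoint and `‖a‖ ≤ 1`. It is `1 - (a / 2) c(a / 4)`, where `c` is the generating
function of the Catalan numbers, which satisfies `c(t) = 1 + t c(t)²`. -/
theorem exists_isSelfAdjoint_mul_self_eq_one_sub {R : Type*} [NormedRing R] [NormedAlgebra ℝ R]
    [CompleteSpace R] [StarRing R] [ContinuousStar R] [StarModule ℝ R] [NormOneClass R]
    {a : R} (ha : IsSelfAdjoint a) (hn : ‖a‖ ≤ 1) :
    ∃ s : R, IsSelfAdjoint s ∧ s * s = 1 - a := by
  set f : ℕ → R := fun n => ((catalan n : ℝ) / 4 ^ n) • a ^ n with hf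
  have hsum : Summable fun n => ‖f n‖ := by
    refine Summable.of_nonneg_of_le (fun n => norm_nonneg _) (fun n => ?_)
      summable_catalan_div_four_pow
    have h₀ : (0 : ℝ) ≤ (catalan n : ℝ) / 4 ^ n := by positivity
    rw [hf, norm_smul, Real.norm_of_nonneg h₀]
    exact mul_le_of_le_one_right h₀ ((norm_pow_le a n).trans (pow_le_one₀ (norm_nonneg _) hn))
  have hs : Summable f := hsum.of_norm
  set c : R := ∑' n, f n with hc
  have hcomm : a * c = c * a := by
    rw [hc, ← hs.tsum_mul_left, ← hs.tsum_mul_right]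
    refine tsum_congr fun n => ?_
    rw [hf, mul_smul_comm, smul_mul_assoc, ← pow_succ, ← pow_succ']
  have hself : star c = c := by
    rw [hc, tsum_star]
    refine tsum_congr fun n => ?_
    rw [hf, star_smul, star_pow, ha.star_eq, star_trivial]
  have hrec : c = 1 + (1 / 4 : ℝ) • (a * (c * c)) := by
    have h₁ : c * c = ∑' n : ℕ, ∑ kl ∈ Finset.HasAntidiagonal.antidiagonal n, f kl.1 * f kl.2 :=
      tsum_mul_tsum_eq_tsum_sum_antidiagonal_of_summable_norm hsum hsum
    have h₂ : Summable fun n : ℕ => ∑ kl ∈ Finset.HasAntidiagonal.antidiagonal n, f kl.1 * f kl.2 :=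
      (summable_norm_sum_mul_antidiagonal_of_summable_norm hsum hsum).of_norm
    conv_lhs => rw [hc, hs.tsum_eq_zero_add]
    rw [h₁, ← h₂.tsum_mul_left, ← Summable.tsum_const_smul _ (h₂.mul_left a)]
    congr 1
    · simp [hf]
    · refine tsum_congr fun n => ?_
      have h₃ : ∑ kl ∈ Finset.HasAntidiagonal.antidiagonal n, f kl.1 * f kl.2
          = ((catalan (n + 1) : ℝ) / 4 ^ n) • a ^ n := by
        rw [catalan_succ', Nat.cast_sum, Finset.sum_div, Finset.sum_smul]
        refine Finset.sum_congr rfl fun kl hkl => ?_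
        rw [← Finset.HasAntidiagonal.mem_antidiagonal.mp hkl, hf, smul_mul_smul_comm, ← pow_add, pow_add 4,
          Nat.cast_mul, mul_div_mul_comm]
      have h₄ : (1 / 4 : ℝ) * ((catalan (n + 1) : ℝ) / 4 ^ n) =
          (catalan (n + 1) : ℝ) / 4 ^ (n + 1) := by
        ring
      rw [h₃, hf, mul_smul_comm, smul_smul, ← pow_succ', h₄]
  refine ⟨1 - (1 / 2 : ℝ) • (a * c), ?_, ?_⟩
  · rw [IsSelfAdjoint, star_sub, star_one, star_smul, star_mul, hself, ha.star_eq, star_trivial,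
      hcomm]
  · have h₁ : (a * c) * (a * c) = (4 : ℝ) • (a * c - a) := by
      have h₂ : a * c - a = (1 / 4 : ℝ) • (a * (a * (c * c))) := by
        nth_rw 1 [hrec]
        rw [mul_add, mul_one, add_sub_cancel_left, mul_smul_comm]
      rw [h₂, smul_smul, mul_assoc a c, ← mul_assoc c a, ← hcomm, mul_assoc a c c]
      norm_num
    rw [sub_mul, one_mul, mul_sub, mul_one, smul_mul_smul_comm, h₁]
    module

/-- For a positive operator with `‖T‖ ≤ 1`, `T² ≤ T`. -/
theorem norm_sq_apply_le_inner_of_norm_le_one {H : Type*} [NormedAddCommGroup H]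
    [InnerProductSpace ℝ H] {T : H →L[ℝ] H}
    (hsymm : ∀ f g, inner ℝ (T f) g = inner ℝ f (T g)) (hpos : ∀ f, 0 ≤ inner ℝ (T f) f)
    (hT : ‖T‖ ≤ 1) (f : H) : ‖T f‖ ^ 2 ≤ inner ℝ (T f) f := by
  -- `T - T² = (1 - T) T (1 - T) + T (1 - T) T`
  have h₁ := hpos (f - T f)
  have h₂ : inner ℝ (T (T f)) (T f) ≤ ‖T f‖ ^ 2 := by
    refine (real_inner_le_norm _ _).trans ?_
    rw [sq]
    gcongr
    exact (T.le_opNorm _).trans (mul_le_of_le_one_left (norm_nonneg _) hT)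
  rw [map_sub, inner_sub_left, inner_sub_right, inner_sub_right, hsymm (T f) f,
    real_inner_self_eq_norm_sq] at h₁
  linarith

/-- A positive operator on a real Hilbert space has a self-adjoint square root. -/
theorem exists_isSelfAdjoint_mul_self_eq {H : Type*} [NormedAddCommGroup H]
    [InnerProductSpace ℝ H] [CompleteSpace H] {T : H →L[ℝ] H}
    (hsymm : ∀ f g, inner ℝ (T f) g = inner ℝ f (T g)) (hpos : ∀ f, 0 ≤ inner ℝ (T f) f) :
    ∃ S : H →L[ℝ] H, (∀ f g, inner ℝ (S f) g = inner ℝ f (S g)) ∧ ∀ f, S (S f) = T f := by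
  rcases eq_or_ne T 0 with rfl | hT
  · exact ⟨0, by simp, by simp⟩
  have hT₀ : 0 < ‖T‖ := norm_pos_iff.mpr hT
  have : Nontrivial H := by
    by_contra h
    rw [not_nontrivial_iff_subsingleton] at h
    exact hT (Subsingleton.elim _ _)
  set T₁ : H →L[ℝ] H := ‖T‖⁻¹ • T with hT₁
  have hsymm₁ : ∀ f g, inner ℝ (T₁ f) g = inner ℝ f (T₁ g) := fun f g => by
    simp [hT₁, real_inner_smul_left, real_inner_smul_right, hsymm]
  have hpos₁ : ∀ f, 0 ≤ inner ℝ (T₁ f) f := fun f => by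
    simp only [hT₁, smul_apply, real_inner_smul_left]
    exact mul_nonneg (by positivity) (hpos f)
  have hnorm₁ : ‖T₁‖ ≤ 1 := by
    rw [hT₁, norm_smul, norm_inv, norm_norm, inv_mul_cancel₀ hT₀.ne']
  have hself : IsSelfAdjoint (1 - T₁) :=
    (IsSelfAdjoint.one _).sub
      ((ContinuousLinearMap.isSelfAdjoint_iff_isSymmetric).mpr fun f g => hsymm₁ f g)
  have hle : ‖1 - T₁‖ ≤ 1 := by
    refine ContinuousLinearMap.opNorm_le_bound _ zero_le_one fun f => ?_
    rw [one_mul]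
    refine (sq_le_sq₀ (norm_nonneg _) (norm_nonneg _)).mp ?_
    have := norm_sq_apply_le_inner_of_norm_le_one hsymm₁ hpos₁ hnorm₁ f
    have h₀ := hpos₁ f
    rw [sub_apply, one_apply_eq_self, norm_sub_sq_real, real_inner_comm]
    linarith
  obtain ⟨S, hS, hSS⟩ := exists_isSelfAdjoint_mul_self_eq_one_sub hself hle
  rw [sub_sub_cancel] at hSS
  refine ⟨Real.sqrt ‖T‖ • S, fun f g => ?_, fun f => ?_⟩
  · have := ContinuousLinearMap.isSelfAdjoint_iff_isSymmetric.mp hS f g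
    simp only [ContinuousLinearMap.coe_coe] at this
    simp [real_inner_smul_left, real_inner_smul_right, this]
  · have := DFunLike.congr_fun hSS f
    simp only [mul_apply_eq_comp] at this
    simp only [smul_apply, map_smul, smul_smul, this, hT₁]
    rw [← mul_assoc, Real.mul_self_sqrt hT₀.le, mul_inv_cancel₀ hT₀.ne', one_smul]

/-! ### Energies of differences of finite measures -/

section Energy

variable {Ω : Type*} [MeasurableSpace Ω]

theorem integral_toSignedMeasure_sub {α β : Measure Ω} [IsFiniteMeasure α] [IsFiniteMeasure β]
    {g : Ω → ℝ} (hα : Integrable g α) (hβ : Integrable g β) :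
    ∫ᵛ x, g x ∂<•(α.toSignedMeasure - β.toSignedMeasure) = ∫ x, g x ∂α - ∫ x, g x ∂β := by
  rw [VectorMeasure.integral_sub_vectorMeasure, VectorMeasure.integral_toSignedMeasure,
    VectorMeasure.integral_toSignedMeasure]
  · rwa [VectorMeasure.Integrable, Measure.variation_toSignedMeasure]
  · rwa [VectorMeasure.Integrable, Measure.variation_toSignedMeasure]

theorem energy_toSignedMeasure_sub {K : Ω → Ω → ℝ} {α β : Measure Ω} [IsFiniteMeasure α]
    [IsFiniteMeasure β] (hα : ∀ x, Integrable (K x) α) (hβ : ∀ x, Integrable (K x) β)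
    (hαα : Integrable (fun x => ∫ y, K x y ∂α) α) (hαβ : Integrable (fun x => ∫ y, K x y ∂α) β)
    (hβα : Integrable (fun x => ∫ y, K x y ∂β) α) (hββ : Integrable (fun x => ∫ y, K x y ∂β) β) :
    energy K (α.toSignedMeasure - β.toSignedMeasure) =
      ((∫ x, ∫ y, K x y ∂α ∂α) - ∫ x, ∫ y, K x y ∂β ∂α) -
        ((∫ x, ∫ y, K x y ∂α ∂β) - ∫ x, ∫ y, K x y ∂β ∂β) := by
  have h : ∀ x, ∫ᵛ y, K x y ∂<•(α.toSignedMeasure - β.toSignedMeasure)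
      = ∫ y, K x y ∂α - ∫ y, K x y ∂β := fun x => integral_toSignedMeasure_sub (hα x) (hβ x)
  simp only [energy, h]
  rw [← integral_sub hαα hβα, ← integral_sub hαβ hββ]
  exact integral_toSignedMeasure_sub (hαα.sub hβα) (hαβ.sub hββ)

/-- A measure below a finite inner regular measure is regular. -/
theorem regular_of_le [TopologicalSpace Ω] [BorelSpace Ω] [T2Space Ω] {m l : Measure Ω}
    [IsFiniteMeasure l] [l.InnerRegular] (h : m ≤ l) : m.Regular := by
  have : IsFiniteMeasure m := isFiniteMeasure_of_le l h
  have : m.InnerRegular := by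
    refine ⟨fun s hs r hr => ?_⟩
    obtain ⟨K, hKs, hK, hlt⟩ := hs.exists_isCompact_sdiff_lt (μ := l) (measure_ne_top l s)
      (tsub_pos_of_lt hr).ne'
    refine ⟨K, hKs, hK, ?_⟩
    have h₁ : m s ≤ m K + m (s \ K) := by
      refine (measure_mono ?_).trans (measure_union_le _ _)
      rw [Set.union_sdiff_self]
      exact Set.subset_union_right
    have h₂ : m (s \ K) < m s - r := (h _).trans_lt hlt
    by_contra! hle
    have h₃ : m K + m (s \ K) < r + (m s - r) :=
      ENNReal.add_lt_add_of_le_of_lt (measure_ne_top m K) hle h₂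
    rw [add_tsub_cancel_of_le hr.le] at h₃
    exact absurd (h₁.trans_lt h₃) (lt_irrefl _)
  infer_instance

theorem innerRegular_dirac [TopologicalSpace Ω] [BorelSpace Ω] [T1Space Ω] (x : Ω) :
    (Measure.dirac x).InnerRegular := by
  refine ⟨fun s hs r hr => ?_⟩
  by_cases hx : x ∈ s
  · refine ⟨{x}, Set.singleton_subset_iff.mpr hx, isCompact_singleton, ?_⟩
    rw [Measure.dirac_apply_of_mem hx] at hr
    rwa [Measure.dirac_apply_of_mem (Set.mem_singleton x)]
  · rw [Measure.dirac_apply' x hs, Set.indicator_of_notMem hx] at hr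
    exact absurd hr not_lt_zero

end Energy

/-! ### The energy identity for a convolution square root -/

section ConvolutionSqrt

variable {Ω : Type*} [MeasurableSpace Ω] {μ : Measure Ω}
  {L k : Ω → Ω → ℝ} {M : ℝ}

theorem IsConvolutionSqrt.stronglyMeasurable [IsProbabilityMeasure μ] (hk : IsConvolutionSqrt μ L k) :
    StronglyMeasurable (Function.uncurry L) := by
  have h : Function.uncurry L = fun p : Ω × Ω => ∫ z, k p.1 z * k z p.2 ∂μ :=
    funext fun p => hk.eq_integral p.1 p.2
  rw [h]
  have hm : Measurable fun q : (Ω × Ω) × Ω => k q.1.1 q.2 * k q.2 q.1.2 :=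
    (hk.measurable.comp (by fun_prop : Measurable fun q : (Ω × Ω) × Ω => (q.1.1, q.2))).mul
      (hk.measurable.comp (by fun_prop : Measurable fun q : (Ω × Ω) × Ω => (q.2, q.1.2)))
  exact hm.stronglyMeasurable.integral_prod_right

theorem IsConvolutionSqrt.integrable_sq (hk : IsConvolutionSqrt μ L k) (x : Ω) :
    Integrable (fun z => k z x ^ 2) μ :=
  (hk.integrable x x).congr (.of_forall fun z => by simp only [hk.symm x z, sq])

theorem IsConvolutionSqrt.integral_sq (hk : IsConvolutionSqrt μ L k) (x : Ω) :
    ∫ z, k z x ^ 2 ∂μ = L x x := by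
  rw [hk.eq_integral]
  exact integral_congr_ae (.of_forall fun z => by simp only [hk.symm x z, sq])

theorem IsConvolutionSqrt.measurable_right (hk : IsConvolutionSqrt μ L k) (x : Ω) :
    Measurable fun z => k z x :=
  hk.measurable.comp measurable_prodMk_right

/-- If `L` is bounded on the diagonal, then `k(z, ·)` is integrable for almost every `z`, because
`∫ |k(z, x)| dμ(z)` is at most `1 + L(x, x)`. -/
theorem IsConvolutionSqrt.integrable_prod [IsProbabilityMeasure μ] (hk : IsConvolutionSqrt μ L k)
    (hM : ∀ x, L x x ≤ M) (α : Measure Ω) [IsFiniteMeasure α] :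
    Integrable (Function.uncurry k) (μ.prod α) := by
  have hle : ∀ x z, ‖k z x‖ ≤ 1 + k z x ^ 2 := fun x z => by
    rw [Real.norm_eq_abs, ← sq_abs]
    nlinarith [sq_nonneg (|k z x| - 1), abs_nonneg (k z x)]
  have hint : ∀ x, Integrable (fun z => k z x) μ := fun x =>
    ((integrable_const 1).add (hk.integrable_sq x)).mono'
      (hk.measurable_right x).aestronglyMeasurable (.of_forall (hle x))
  refine (integrable_prod_iff' hk.measurable.aestronglyMeasurable).mpr ⟨.of_forall hint, ?_⟩
  refine Integrable.of_bound (C := 1 + M) ?_ (.of_forall fun x => ?_)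
  · exact (hk.measurable.norm.stronglyMeasurable.integral_prod_left (μ := μ)).aestronglyMeasurable
  · rw [Real.norm_of_nonneg (integral_nonneg fun z => norm_nonneg _)]
    calc ∫ z, ‖k z x‖ ∂μ ≤ ∫ z, (1 + k z x ^ 2) ∂μ :=
          integral_mono (hint x).norm ((integrable_const 1).add (hk.integrable_sq x)) (hle x)
      _ = 1 + L x x := by
          rw [integral_add (integrable_const 1) (hk.integrable_sq x), hk.integral_sq]
          simp
      _ ≤ 1 + M := by gcongr; exact hM x

/-- The triple integral behind the energy identity converges absolutely. -/
theorem IsConvolutionSqrt.integrable_triple [IsProbabilityMeasure μ] (hk : IsConvolutionSqrt μ L k)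
    (hM : ∀ x, L x x ≤ M) (α β : Measure Ω) [IsFiniteMeasure α] [IsFiniteMeasure β] :
    Integrable (fun q : Ω × (Ω × Ω) => k q.1 q.2.1 * k q.1 q.2.2) (μ.prod (α.prod β)) := by
  have hm : Measurable fun q : Ω × (Ω × Ω) => k q.1 q.2.1 * k q.1 q.2.2 :=
    (hk.measurable.comp (by fun_prop : Measurable fun q : Ω × (Ω × Ω) => (q.1, q.2.1))).mul
      (hk.measurable.comp (by fun_prop : Measurable fun q : Ω × (Ω × Ω) => (q.1, q.2.2)))
  have hint : ∀ p : Ω × Ω, Integrable (fun z => k z p.1 * k z p.2) μ := fun p =>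
    (hk.integrable p.1 p.2).congr (.of_forall fun z => by simp only [hk.symm p.1 z])
  refine (integrable_prod_iff' hm.aestronglyMeasurable).mpr ⟨.of_forall hint, ?_⟩
  refine Integrable.of_bound (C := M) ?_ (.of_forall fun p => ?_)
  · exact (hm.norm.stronglyMeasurable.integral_prod_left (μ := μ)).aestronglyMeasurable
  · rw [Real.norm_of_nonneg (integral_nonneg fun z => norm_nonneg _)]
    have hs := ((hk.integrable_sq p.1).add (hk.integrable_sq p.2)).const_mul (1 / 2)
    calc ∫ z, ‖k z p.1 * k z p.2‖ ∂μ
        ≤ ∫ z, 1 / 2 * (k z p.1 ^ 2 + k z p.2 ^ 2) ∂μ := by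
          refine integral_mono (hint p).norm hs fun z => ?_
          simp only [norm_mul, Real.norm_eq_abs, ← sq_abs (k z _)]
          nlinarith [sq_nonneg (|k z p.1| - |k z p.2|)]
      _ = 1 / 2 * (L p.1 p.1 + L p.2 p.2) := by
          rw [integral_const_mul, integral_add (hk.integrable_sq _) (hk.integrable_sq _),
            hk.integral_sq, hk.integral_sq]
      _ ≤ M := by linarith [hM p.1, hM p.2]

theorem IsConvolutionSqrt.integrable_mul [IsProbabilityMeasure μ] (hk : IsConvolutionSqrt μ L k)
    (hM : ∀ x, L x x ≤ M) (α β : Measure Ω) [IsFiniteMeasure α] [IsFiniteMeasure β] :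
    Integrable (fun z => (∫ x, k z x ∂α) * ∫ y, k z y ∂β) μ := by
  refine (hk.integrable_triple hM α β).integral_prod_left.congr (.of_forall fun z => ?_)
  exact integral_prod_mul (fun x => k z x) fun y => k z y

/-- The mutual energy of `α` and `β` is the `L²(μ)` product of `∫ k(·, x) dα(x)` and
`∫ k(·, y) dβ(y)`. -/
theorem IsConvolutionSqrt.integral_mul [IsProbabilityMeasure μ] (hk : IsConvolutionSqrt μ L k)
    (hM : ∀ x, L x x ≤ M) (α β : Measure Ω) [IsFiniteMeasure α] [IsFiniteMeasure β] :
    ∫ z, (∫ x, k z x ∂α) * (∫ y, k z y ∂β) ∂μ = ∫ x, ∫ y, L x y ∂β ∂α := by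
  have h := hk.integrable_triple hM α β
  calc ∫ z, (∫ x, k z x ∂α) * (∫ y, k z y ∂β) ∂μ
      = ∫ z, ∫ p : Ω × Ω, k z p.1 * k z p.2 ∂(α.prod β) ∂μ :=
        integral_congr_ae (.of_forall fun z =>
          (integral_prod_mul (fun x => k z x) fun y => k z y).symm)
    _ = ∫ p : Ω × Ω, ∫ z, k z p.1 * k z p.2 ∂μ ∂(α.prod β) := integral_integral_swap h
    _ = ∫ p : Ω × Ω, L p.1 p.2 ∂(α.prod β) := by
        refine integral_congr_ae (.of_forall fun p => ?_)
        simp only [hk.eq_integral, hk.symm p.1]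
    _ = ∫ x, ∫ y, L x y ∂β ∂α := by
        refine integral_prod _ (h.integral_prod_right.congr (.of_forall fun p => ?_))
        simp only [hk.eq_integral, hk.symm p.1]

end ConvolutionSqrt

section Discrepancy

variable {Ω : Type*} [MeasurableSpace Ω] {μ : Measure Ω} [IsProbabilityMeasure μ]
  {K k : Ω → Ω → ℝ} {C I M : ℝ}

omit [IsProbabilityMeasure μ] in
theorem integral_sq_sub_sub {a b c : Ω → ℝ} (haa : Integrable (fun z => a z * a z) μ)
    (hab : Integrable (fun z => a z * b z) μ) (hac : Integrable (fun z => a z * c z) μ)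
    (hbb : Integrable (fun z => b z * b z) μ) (hbc : Integrable (fun z => b z * c z) μ)
    (hcc : Integrable (fun z => c z * c z) μ) :
    Integrable (fun z => (a z - b z - c z) ^ 2) μ ∧
      ∫ z, (a z - b z - c z) ^ 2 ∂μ =
        (∫ z, a z * a z ∂μ) + (∫ z, b z * b z ∂μ) + (∫ z, c z * c z ∂μ)
          - 2 * ((∫ z, a z * b z ∂μ) + (∫ z, a z * c z ∂μ) - ∫ z, b z * c z ∂μ) := by
  have h₁ : Integrable (fun z => a z * a z + b z * b z) μ := haa.add hbb
  have h₂ : Integrable (fun z => a z * a z + b z * b z + c z * c z) μ := h₁.add hcc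
  have h₃ : Integrable (fun z => a z * b z + a z * c z) μ := hab.add hac
  have h₄ : Integrable (fun z => a z * b z + a z * c z - b z * c z) μ := h₃.sub hbc
  have h₅ : (fun z => (a z - b z - c z) ^ 2) = fun z => (a z * a z + b z * b z + c z * c z)
      - 2 * (a z * b z + a z * c z - b z * c z) := by
    ext z
    ring
  rw [h₅]
  refine ⟨h₂.sub (h₄.const_mul 2), ?_⟩
  rw [integral_sub h₂ (h₄.const_mul 2), integral_add h₁ hcc, integral_add haa hbb,
    integral_const_mul, integral_sub h₃ hbc, integral_add hab hac]

theorem IsConvolutionSqrt.stronglyMeasurable_of_add_const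
    (hk : IsConvolutionSqrt μ (fun x y => K x y + C) k) :
    StronglyMeasurable (Function.uncurry K) := by
  have h := hk.stronglyMeasurable.sub (stronglyMeasurable_const (b := C))
  convert h using 1
  ext p
  simp [Function.uncurry]

theorem integrable_section (hKm : StronglyMeasurable (Function.uncurry K))
    (hK : ∀ x y, |K x y| ≤ M) (m : Measure Ω) [IsFiniteMeasure m] (x : Ω) : Integrable (K x) m :=
  .of_bound (C := M) (hKm.comp_measurable measurable_prodMk_left).aestronglyMeasurable
    (.of_forall (hK x))

theorem integrable_potential (hKm : StronglyMeasurable (Function.uncurry K))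
    (hK : ∀ x y, |K x y| ≤ M) (m l : Measure Ω) [IsFiniteMeasure m] [IsFiniteMeasure l] :
    Integrable (fun x => ∫ y, K x y ∂l) m :=
  .of_bound (C := M * l.real Set.univ) hKm.integral_prod_right.aestronglyMeasurable
    (.of_forall fun x => norm_integral_le_of_norm_le_const (.of_forall (hK x)))

/-- The energy identity for `ν = α - β` of total mass one: writing `u_α = ∫ k(·, y) dα(y)`, the
integral of `(u_α - u_β - u_μ)²` is computed by `IsConvolutionSqrt.integral_mul`, and the terms that
contain `μ` are constants by invariance. -/
theorem integral_sq_discrepancy (hk : IsConvolutionSqrt μ (fun x y => K x y + C) k)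
    (hK : ∀ x y, |K x y| ≤ M) (hinv : ∀ x, ∫ y, K x y ∂μ = I)
    (α β : Measure Ω) [IsFiniteMeasure α] [IsFiniteMeasure β]
    (hmass : α.real Set.univ - β.real Set.univ = 1) :
    Integrable (fun z => |∫ y, k z y ∂α - ∫ y, k z y ∂β - ∫ y, k z y ∂μ| ^ 2) μ ∧
    ((∫ x, ∫ y, K x y ∂α ∂α) - ∫ x, ∫ y, K x y ∂β ∂α) -
        ((∫ x, ∫ y, K x y ∂α ∂β) - ∫ x, ∫ y, K x y ∂β ∂β) - I =
      ∫ z, |∫ y, k z y ∂α - ∫ y, k z y ∂β - ∫ y, k z y ∂μ| ^ 2 ∂μ := by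
  have hM : ∀ x, K x x + C ≤ M + C := fun x => by linarith [le_abs_self (K x x), hK x x]
  have hKm := hk.stronglyMeasurable_of_add_const
  have hKint := fun (m : Measure Ω) [IsFiniteMeasure m] => integrable_section hKm hK m
  have hpot := fun (m l : Measure Ω) [IsFiniteMeasure m] [IsFiniteMeasure l] =>
    integrable_potential hKm hK m l
  have hQ : ∀ (m l : Measure Ω) [IsFiniteMeasure m] [IsFiniteMeasure l],
      ∫ z, (∫ x, k z x ∂m) * (∫ y, k z y ∂l) ∂μ
        = (∫ x, ∫ y, K x y ∂l ∂m) + C * m.real Set.univ * l.real Set.univ := fun m l _ _ => by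
    rw [hk.integral_mul hM]
    have h : ∀ x, ∫ y, (K x y + C) ∂l = ∫ y, K x y ∂l + C * l.real Set.univ := fun x => by
      rw [integral_add (hKint l x) (integrable_const C), integral_const, smul_eq_mul, mul_comm C]
    simp only [h]
    rw [integral_add (hpot m l) (integrable_const _), integral_const, smul_eq_mul]
    ring
  have hm := hk.integrable_mul hM
  obtain ⟨hint, heq⟩ := integral_sq_sub_sub (hm α α) (hm α β) (hm α μ) (hm β β) (hm β μ) (hm μ μ)
  have hsymm : ∫ x, ∫ y, K x y ∂β ∂α = ∫ x, ∫ y, K x y ∂α ∂β := by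
    have h := integral_congr_ae (μ := μ) (.of_forall fun z =>
      mul_comm (∫ x, k z x ∂α) (∫ y, k z y ∂β))
    rw [hQ, hQ] at h
    linarith
  simp only [sq_abs]
  refine ⟨hint, ?_⟩
  rw [heq]
  simp only [hQ, hinv, integral_const, smul_eq_mul, probReal_univ]
  have hα : α.real Set.univ = 1 + β.real Set.univ := by linarith
  rw [hα, hsymm]
  ring

theorem wellDefined_and_energy_sub_eq_l2DiscrepancySq
    (hk : IsConvolutionSqrt μ (fun x y => K x y + C) k)
    (hK : ∀ x y, |K x y| ≤ M) (hinv : IsInvariantMeasure K μ) (ν : SignedMeasure Ω)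
    (hν : ν Set.univ = 1) :
    L2DiscrepancyWellDefined k μ ν ∧
      energy K ν - energy K μ.toSignedMeasure = l2DiscrepancySq k μ ν := by
  obtain ⟨α, β, hα, hβ, rfl, hvar⟩ : ∃ α β : Measure Ω, ∃ (_ : IsFiniteMeasure α)
      (_ : IsFiniteMeasure β), ν = α.toSignedMeasure - β.toSignedMeasure ∧
        ν.variation = α + β := by
    refine ⟨ν.toJordanDecomposition.posPart, ν.toJordanDecomposition.negPart, inferInstance,
      inferInstance, ?_, ?_⟩
    · exact (SignedMeasure.toSignedMeasure_toJordanDecomposition ν).symm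
    · rw [← SignedMeasure.totalVariation_eq_variation]
      rfl
  have hM : ∀ x, K x x + C ≤ M + C := fun x => by linarith [le_abs_self (K x x), hK x x]
  have hmass : α.real Set.univ - β.real Set.univ = 1 := by
    rw [← hν, sub_apply, Measure.toSignedMeasure_apply_measurable .univ,
      Measure.toSignedMeasure_apply_measurable .univ]
  have hsec : ∀ (m : Measure Ω) [IsFiniteMeasure m], ∀ᵐ x ∂μ, Integrable (fun y => k x y) m :=
    fun m _ => (hk.integrable_prod hM m).prod_right_ae
  obtain ⟨hint, heq⟩ := integral_sq_discrepancy hk hK hinv α β hmass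
  have hloc : (fun x => |localDiscrepancy k μ (α.toSignedMeasure - β.toSignedMeasure) x| ^ 2)
      =ᵐ[μ] fun z => |∫ y, k z y ∂α - ∫ y, k z y ∂β - ∫ y, k z y ∂μ| ^ 2 := by
    filter_upwards [hsec α, hsec β] with x h₁ h₂
    rw [localDiscrepancy, integral_toSignedMeasure_sub h₁ h₂]
  refine ⟨⟨?_, hsec μ, hint.congr hloc.symm⟩, ?_⟩
  · filter_upwards [hsec α, hsec β] with x h₁ h₂
    rw [VectorMeasure.Integrable, hvar]
    exact h₁.add_measure h₂
  · have hKm := hk.stronglyMeasurable_of_add_const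
    have hKint := fun (m : Measure Ω) [IsFiniteMeasure m] => integrable_section hKm hK m
    have hpot := fun (m l : Measure Ω) [IsFiniteMeasure m] [IsFiniteMeasure l] =>
      integrable_potential hKm hK m l
    rw [l2DiscrepancySq, integral_congr_ae hloc, ← heq,
      energy_toSignedMeasure_sub (hKint α) (hKint β) (hpot α α) (hpot β α) (hpot α β) (hpot β β)]

theorem integrable_and_discreteEnergy_sub_eq [MeasurableSingletonClass Ω]
    (hk : IsConvolutionSqrt μ (fun x y => K x y + C) k)
    (hK : ∀ x y, |K x y| ≤ M) (hinv : IsInvariantMeasure K μ) {N : ℕ} (z : Fin N → Ω)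
    (hN : 0 < N) :
    Integrable (fun x => |discreteLocalDiscrepancy k μ z x| ^ 2) μ ∧
      discreteEnergy K z - energy K μ.toSignedMeasure = discreteL2DiscrepancySq k μ z := by
  set α : Measure Ω := (N : NNReal)⁻¹ • ∑ i, Measure.dirac (z i) with hα
  have hint : ∀ f : Ω → ℝ, ∫ y, f y ∂α = 1 / (N : ℝ) * ∑ i, f (z i) := fun f => by
    rw [hα, integral_smul_nnreal_measure,
      integral_finsetSum_measure fun i _ => integrable_dirac (by simp)]
    simp [NNReal.smul_def]
  have hmass : α.real Set.univ - (0 : Measure Ω).real Set.univ = 1 := by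
    have h := hint fun _ => 1
    simp only [integral_const, smul_eq_mul, mul_one, Finset.sum_const, Finset.card_univ,
      Fintype.card_fin, nsmul_eq_mul] at h
    have hN' : (N : ℝ) ≠ 0 := by positivity
    rw [h, measureReal_zero]
    field_simp
    simp
  obtain ⟨h₁, h₂⟩ := integral_sq_discrepancy hk hK hinv α 0 hmass
  simp only [integral_zero_measure, sub_zero, Finset.sum_const_zero, mul_zero, hint] at h₁ h₂
  refine ⟨h₁, ?_⟩
  rw [discreteL2DiscrepancySq]
  unfold discreteLocalDiscrepancy
  rw [← h₂, discreteEnergy]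
  congr 1
  simp only [← Finset.mul_sum]
  ring

end Discrepancy

/-! ### Factorization through a square root -/

section Factorization

variable {H F : Type*} [NormedAddCommGroup H] [InnerProductSpace ℝ H] [CompleteSpace H]
  [NormedAddCommGroup F] [NormedSpace ℝ F]

omit [CompleteSpace H] in
theorem apply_eq_zero_of_mem_orthogonal_closure_range {S : H →L[ℝ] H}
    (hS : ∀ f g, inner ℝ (S f) g = inner ℝ f (S g)) {g : H}
    (hg : g ∈ (LinearMap.range (S : H →ₗ[ℝ] H)).topologicalClosureᗮ) : S g = 0 := by
  rw [← inner_self_eq_zero (𝕜 := ℝ), hS, ← real_inner_comm]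
  exact (Submodule.mem_orthogonal _ _).mp hg _
    (Submodule.le_topologicalClosure _ (LinearMap.mem_range_self _ (S g)))

/-- A bounded operator that vanishes on the range and on the kernel of a symmetric operator
is zero. -/
theorem eq_zero_of_vanish_on_range_and_ker {S : H →L[ℝ] H}
    (hS : ∀ f g, inner ℝ (S f) g = inner ℝ f (S g)) {D : H →L[ℝ] F}
    (hrange : ∀ f, D (S f) = 0) (hker : ∀ g, S g = 0 → D g = 0) : D = 0 := by
  set V := (LinearMap.range (S : H →ₗ[ℝ] H)).topologicalClosure with hV
  have hcl : V ≤ LinearMap.ker (D : H →ₗ[ℝ] F) := by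
    refine Submodule.topologicalClosure_minimal _ ?_ D.isClosed_ker
    rintro _ ⟨f, rfl⟩
    exact hrange f
  have : CompleteSpace V := (Submodule.isClosed_topologicalClosure _).completeSpace_coe
  ext g
  obtain ⟨u, hu, u', hu', rfl⟩ := V.exists_add_mem_mem_orthogonal g
  rw [map_add, hker _ (apply_eq_zero_of_mem_orthogonal_closure_range hS hu'), add_zero]
  exact hcl hu

/-- If `‖A f‖ ≤ c ‖S f‖` for a symmetric operator `S`, then `A = B S` for a bounded operator `B`
that vanishes on the kernel of `S`. -/
theorem exists_comp_eq_of_norm_le [CompleteSpace F] {S : H →L[ℝ] H}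
    (hS : ∀ f g, inner ℝ (S f) g = inner ℝ f (S g)) {A : H →L[ℝ] F} {c : ℝ}
    (hA : ∀ f, ‖A f‖ ≤ c * ‖S f‖) :
    ∃ B : H →L[ℝ] F, (∀ f, B (S f) = A f) ∧ ∀ g, S g = 0 → B g = 0 := by
  set V := (LinearMap.range (S : H →ₗ[ℝ] H)).topologicalClosure with hV
  have : CompleteSpace V := (Submodule.isClosed_topologicalClosure _).completeSpace_coe
  have hmem : ∀ f, S f ∈ V := fun f =>
    Submodule.le_topologicalClosure _ (LinearMap.mem_range_self _ f)
  set e : H →ₗ[ℝ] V := (S : H →ₗ[ℝ] H).codRestrict V hmem with he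
  have hdense : DenseRange e := by
    intro u
    rw [Metric.mem_closure_iff]
    intro ε hε
    obtain ⟨_, ⟨f, rfl⟩, hf⟩ := Metric.mem_closure_iff.mp u.2 ε hε
    exact ⟨e f, ⟨f, rfl⟩, hf⟩
  refine ⟨(A : H →ₗ[ℝ] F).extendOfNorm e ∘L V.orthogonalProjectionOnto, fun f => ?_, fun g hg => ?_⟩
  · have h : V.orthogonalProjectionOnto (S f) = e f :=
      Submodule.orthogonalProjectionOnto_mem_subspace_eq_self (K := V) (e f)
    rw [ContinuousLinearMap.comp_apply, h]
    exact LinearMap.extendOfNorm_eq hdense ⟨c, fun x => hA x⟩ f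
  · have h : g ∈ Vᗮ := by
      rw [hV, Submodule.orthogonal_closure, Submodule.mem_orthogonal]
      rintro _ ⟨f, rfl⟩
      simp [hS, hg]
    rw [ContinuousLinearMap.comp_apply,
      Submodule.orthogonalProjectionOnto_apply_of_mem_orthogonal h, map_zero]

end Factorization

/-! ### Integral operators of continuous positive definite kernels -/

section Feature

variable {Ω : Type*} [TopologicalSpace Ω] [CompactSpace Ω]

/-- The operator `g ↦ (x ↦ ⟪w x, g⟫)` from a Hilbert space to the continuous functions that is
defined by a continuous family `w` of vectors. -/
noncomputable def pairing {H : Type*} [NormedAddCommGroup H] [InnerProductSpace ℝ H] (w : C(Ω, H)) :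
    H →L[ℝ] C(Ω, ℝ) :=
  LinearMap.mkContinuous
    { toFun := fun g => ⟨fun x => inner ℝ (w x) g, by fun_prop⟩
      map_add' := fun f g => by ext x; simp [inner_add_right]
      map_smul' := fun c g => by ext x; simp [real_inner_smul_right] }
    ‖w‖ fun g => by
      refine (ContinuousMap.norm_le _ (by positivity)).mpr fun x => ?_
      refine (norm_inner_le_norm (w x) g).trans ?_
      gcongr
      exact w.norm_coe_le_norm x

@[simp]
theorem pairing_apply {H : Type*} [NormedAddCommGroup H] [InnerProductSpace ℝ H] (w : C(Ω, H))
    (g : H) (x : Ω) : pairing w g x = inner ℝ (w x) g := rfl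

variable [T2Space Ω] [MeasurableSpace Ω] [BorelSpace Ω]

/-- The family of sections `x ↦ L(x, ·)` of a continuous function, as a map into `L²(μ)`. -/
noncomputable def sectionMap (L : C(Ω × Ω, ℝ)) (μ : Measure Ω) [IsFiniteMeasure μ] :
    C(Ω, Lp ℝ 2 μ) :=
  ⟨fun x => ContinuousMap.toLp 2 μ ℝ (L.curry x), by fun_prop⟩

variable {L : C(Ω × Ω, ℝ)} {μ : Measure Ω} [IsFiniteMeasure μ]

omit [T2Space Ω] in
theorem pairing_sectionMap_toLp (f : C(Ω, ℝ)) (x : Ω) :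
    pairing (sectionMap L μ) (ContinuousMap.toLp 2 μ ℝ f) x = ∫ y, f y * L (x, y) ∂μ :=
  ContinuousMap.inner_toLp μ (L.curry x) f

/-- Integration against the signed measure `s δ_x + f μ`. -/
theorem integral_smul_dirac_add_withDensity (f : C(Ω, ℝ)) (x : Ω) (s : NNReal) :
    ∃ ν : SignedMeasure Ω, (μ.Regular → IsRegularSigned ν) ∧
      ∀ g : C(Ω, ℝ), ∫ᵛ y, g y ∂<•ν = s * g x + ∫ y, f y * g y ∂μ := by
  have hp : Measurable fun y => (f y).toNNReal := f.continuous.measurable.real_toNNReal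
  have hn : Measurable fun y => (-f y).toNNReal := f.continuous.measurable.neg.real_toNNReal
  have hle : ∀ h : Ω → NNReal, (∀ y, h y ≤ ‖f‖₊) →
      μ.withDensity (fun y => (h y : ℝ≥0∞)) ≤ ‖f‖₊ • μ := fun h hh => by
    have h₁ : μ.withDensity (fun _ => (‖f‖₊ : ℝ≥0∞)) = ‖f‖₊ • μ := withDensity_const _
    rw [← h₁]
    exact withDensity_mono (.of_forall fun y => ENNReal.coe_le_coe.mpr (hh y))
  have hlep := hle (fun y => (f y).toNNReal) fun y =>
    Real.toNNReal_le_iff_le_coe.mpr ((le_abs_self _).trans (f.norm_coe_le_norm y))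
  have hlen := hle (fun y => (-f y).toNNReal) fun y =>
    Real.toNNReal_le_iff_le_coe.mpr ((neg_le_abs _).trans (f.norm_coe_le_norm y))
  have : IsFiniteMeasure (μ.withDensity fun y => ((f y).toNNReal : ℝ≥0∞)) :=
    isFiniteMeasure_of_le _ hlep
  have : IsFiniteMeasure (μ.withDensity fun y => ((-f y).toNNReal : ℝ≥0∞)) :=
    isFiniteMeasure_of_le _ hlen
  refine ⟨(s • Measure.dirac x +
    μ.withDensity fun y => ((f y).toNNReal : ℝ≥0∞)).toSignedMeasure -
      (μ.withDensity fun y => ((-f y).toNNReal : ℝ≥0∞)).toSignedMeasure, fun hμ => ?_, fun g => ?_⟩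
  · have := innerRegular_dirac x
    refine regular_of_le (l := s • Measure.dirac x + ‖f‖₊ • μ + ‖f‖₊ • μ) ?_
    refine VectorMeasure.variation_sub_le.trans ?_
    rw [Measure.variation_toSignedMeasure, Measure.variation_toSignedMeasure]
    gcongr
  · have hg : ∀ (m : Measure Ω) [IsFiniteMeasure m], Integrable g m := fun m _ =>
      g.continuous.integrable_of_hasCompactSupport (.of_compactSpace _)
    have hfg : Integrable (fun y => (f y).toNNReal • g y) μ :=
      (integrable_withDensity_iff_integrable_smul hp).mp (hg _)
    have hfg' : Integrable (fun y => (-f y).toNNReal • g y) μ :=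
      (integrable_withDensity_iff_integrable_smul hn).mp (hg _)
    rw [integral_toSignedMeasure_sub (hg _) (hg _), integral_add_measure (hg _) (hg _),
      integral_smul_nnreal_measure, integral_dirac, integral_withDensity_eq_integral_smul hp,
      integral_withDensity_eq_integral_smul hn, add_sub_assoc, ← integral_sub hfg hfg']
    congr 1
    refine integral_congr_ae (.of_forall fun y => ?_)
    simp only [NNReal.smul_def, smul_eq_mul, Real.coe_toNNReal']
    rw [← sub_mul, max_zero_sub_max_neg_zero_eq_self]

/-- Positive definiteness tested on the measures `s δ_x + f μ`. -/
theorem quadratic_nonneg [μ.Regular] (hsymm : ∀ x y, L (x, y) = L (y, x))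
    (hpos : IsPositiveDefinite fun x y => L (x, y)) (f : C(Ω, ℝ)) (x : Ω) (s : NNReal) :
    0 ≤ L (x, x) * (s * s) + 2 * pairing (sectionMap L μ) (ContinuousMap.toLp 2 μ ℝ f) x * s +
      ∫ y, f y * pairing (sectionMap L μ) (ContinuousMap.toLp 2 μ ℝ f) y ∂μ := by
  obtain ⟨ν, hν, hint⟩ := integral_smul_dirac_add_withDensity (μ := μ) f x s
  set U := pairing (sectionMap L μ) (ContinuousMap.toLp 2 μ ℝ f) with hU
  have h₁ : ∀ z, ∫ᵛ y, L (z, y) ∂<•ν = ((s : ℝ) • L.curry x + U) z := fun z => by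
    have h := hint (L.curry z)
    simp only [ContinuousMap.curry_apply] at h
    rw [h, ContinuousMap.add_apply, ContinuousMap.smul_apply, ContinuousMap.curry_apply,
      smul_eq_mul, hsymm x z, hU, pairing_sectionMap_toLp]
  have h₂ := hpos ν (hν inferInstance)
  simp only [energy, h₁] at h₂
  have hf : ∀ g : C(Ω, ℝ), Integrable (fun y => f y * g y) μ := fun g =>
    (f * g).continuous.integrable_of_hasCompactSupport (.of_compactSpace _)
  have h₃ : ∫ y, f y * ((s : ℝ) • L.curry x + U) y ∂μ = s * U x + ∫ y, f y * U y ∂μ := by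
    have h : ∀ y, f y * ((s : ℝ) • L.curry x + U) y = s * (f y * L.curry x y) + f y * U y :=
      fun y => by
        rw [ContinuousMap.add_apply, ContinuousMap.smul_apply, smul_eq_mul]
        ring
    simp only [h]
    rw [integral_add ((hf (L.curry x)).const_mul _) (hf U), integral_const_mul, hU,
      pairing_sectionMap_toLp]
    rfl
  rw [hint, h₃] at h₂
  simp only [ContinuousMap.add_apply, ContinuousMap.smul_apply, ContinuousMap.curry_apply,
    smul_eq_mul] at h₂
  linarith

/-- The integral operator on `L²(μ)` with kernel `L`. -/
noncomputable def integralOp (L : C(Ω × Ω, ℝ)) (μ : Measure Ω) [IsFiniteMeasure μ] :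
    Lp ℝ 2 μ →L[ℝ] Lp ℝ 2 μ :=
  ContinuousMap.toLp 2 μ ℝ ∘L pairing (sectionMap L μ)

omit [T2Space Ω] in
theorem inner_integralOp_toLp (f g : C(Ω, ℝ)) :
    inner ℝ (integralOp L μ (ContinuousMap.toLp 2 μ ℝ f)) (ContinuousMap.toLp 2 μ ℝ g) =
      ∫ x, g x * pairing (sectionMap L μ) (ContinuousMap.toLp 2 μ ℝ f) x ∂μ :=
  ContinuousMap.inner_toLp μ (pairing (sectionMap L μ) (ContinuousMap.toLp 2 μ ℝ f)) g

theorem denseRange_toLp [μ.Regular] :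
    DenseRange (ContinuousMap.toLp 2 μ ℝ : C(Ω, ℝ) →L[ℝ] Lp ℝ 2 μ) :=
  ContinuousMap.toLp_denseRange ℝ μ ℝ (by simp)

theorem inner_integralOp_comm [μ.Regular] (hsymm : ∀ x y, L (x, y) = L (y, x)) (f g : Lp ℝ 2 μ) :
    inner ℝ (integralOp L μ f) g = inner ℝ f (integralOp L μ g) := by
  refine denseRange_toLp.induction_on
    (p := fun f => inner ℝ (integralOp L μ f) g = inner ℝ f (integralOp L μ g)) f
    (isClosed_eq (by fun_prop) (by fun_prop)) fun f => ?_
  refine denseRange_toLp.induction_on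
    (p := fun g => inner ℝ (integralOp L μ (ContinuousMap.toLp 2 μ ℝ f)) g =
      inner ℝ (ContinuousMap.toLp 2 μ ℝ f) (integralOp L μ g)) g
    (isClosed_eq (by fun_prop) (by fun_prop)) fun g => ?_
  rw [real_inner_comm _ (ContinuousMap.toLp 2 μ ℝ f), inner_integralOp_toLp, inner_integralOp_toLp]
  simp only [pairing_sectionMap_toLp, ← integral_const_mul]
  rw [integral_integral_swap_of_hasCompactSupport (by fun_prop) (.of_compactSpace _)]
  refine integral_congr_ae (.of_forall fun x => integral_congr_ae (.of_forall fun y => ?_))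
  simp only [hsymm x y]
  ring

theorem inner_integralOp_self_nonneg [μ.Regular] (hsymm : ∀ x y, L (x, y) = L (y, x))
    (hpos : IsPositiveDefinite fun x y => L (x, y)) (f : Lp ℝ 2 μ) :
    0 ≤ inner ℝ (integralOp L μ f) f := by
  refine denseRange_toLp.induction_on (p := fun f => 0 ≤ inner ℝ (integralOp L μ f) f) f
    (isClosed_le (by fun_prop) (by fun_prop)) fun f => ?_
  rcases isEmpty_or_nonempty Ω with h | ⟨⟨x⟩⟩
  · rw [inner_integralOp_toLp, integral_of_isEmpty]
  · simpa [inner_integralOp_toLp] using quadratic_nonneg (μ := μ) hsymm hpos f x 0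

/-- The Cauchy–Schwarz inequality for the energy form, applied to `δ_x` and `f μ`. -/
theorem sq_pairing_sectionMap_le [μ.Regular] (hsymm : ∀ x y, L (x, y) = L (y, x))
    (hpos : IsPositiveDefinite fun x y => L (x, y)) (f : Lp ℝ 2 μ) (x : Ω) :
    pairing (sectionMap L μ) f x ^ 2 ≤ L (x, x) * inner ℝ (integralOp L μ f) f := by
  refine denseRange_toLp.induction_on
    (p := fun f => pairing (sectionMap L μ) f x ^ 2 ≤ L (x, x) * inner ℝ (integralOp L μ f) f) f
    (isClosed_le (by simp only [pairing_apply]; fun_prop) (by fun_prop)) fun f => ?_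
  · rw [inner_integralOp_toLp]
    have h := discrim_le_zero (a := L (x, x))
      (b := 2 * pairing (sectionMap L μ) (ContinuousMap.toLp 2 μ ℝ f) x)
      (c := ∫ y, f y * pairing (sectionMap L μ) (ContinuousMap.toLp 2 μ ℝ f) y ∂μ) fun s => by
        rcases le_total 0 s with hs | hs
        · exact quadratic_nonneg (μ := μ) hsymm hpos f x ⟨s, hs⟩
        · have h := quadratic_nonneg (μ := μ) hsymm hpos (-f) x (-s).toNNReal
          simpa only [map_neg, ContinuousMap.neg_apply, neg_mul_neg, mul_neg, neg_mul,
            Real.coe_toNNReal _ (neg_nonneg.mpr hs), neg_neg] using h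
    rw [discrim] at h
    linarith

/-- A continuous positive definite kernel is the Gram matrix of a continuous family `w` in `L²(μ)`,
`L(x, y) = ⟪w x, w y⟫`, whose integral operator `g ↦ ⟪w ·, g⟫` is symmetric. That operator is a square
root `S` of the integral operator `T` of `L`. By Cauchy–Schwarz the functions `T f` are bounded by a
multiple of `‖S f‖`, so `S` takes values in the continuous functions, and `w x` represents the
functional `g ↦ (S g)(x)`. -/
theorem exists_feature_map [μ.Regular] [μ.IsOpenPosMeasure] (hsymm : ∀ x y, L (x, y) = L (y, x))
    (hpos : IsPositiveDefinite fun x y => L (x, y)) :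
    ∃ w : C(Ω, Lp ℝ 2 μ), (∀ x y, inner ℝ (w x) (w y) = L (x, y)) ∧
      ∀ f g : Lp ℝ 2 μ, inner ℝ (ContinuousMap.toLp 2 μ ℝ (pairing w f)) g =
        inner ℝ f (ContinuousMap.toLp 2 μ ℝ (pairing w g)) := by
  obtain ⟨S, hS, hSS⟩ := exists_isSelfAdjoint_mul_self_eq (inner_integralOp_comm (μ := μ) hsymm)
    (inner_integralOp_self_nonneg hsymm hpos)
  have hbound : ∀ f, ‖pairing (sectionMap L μ) f‖ ≤ Real.sqrt ‖L‖ * ‖S f‖ := fun f => by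
    refine (ContinuousMap.norm_le _ (by positivity)).mpr fun x => ?_
    refine Real.abs_le_sqrt (sq_pairing_sectionMap_le hsymm hpos f x) |>.trans ?_
    rw [← hSS, hS, real_inner_self_eq_norm_sq]
    rw [Real.sqrt_le_left (by positivity), mul_pow, Real.sq_sqrt (norm_nonneg _)]
    gcongr
    exact (le_abs_self _).trans (L.norm_coe_le_norm _)
  obtain ⟨B, hB, hBker⟩ := exists_comp_eq_of_norm_le hS hbound
  have hBS : ∀ g, ContinuousMap.toLp 2 μ ℝ (B g) = S g := by
    have h := eq_zero_of_vanish_on_range_and_ker hS (D := ContinuousMap.toLp 2 μ ℝ ∘L B - S)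
      (fun f => by
        rw [sub_apply, ContinuousLinearMap.comp_apply, hB, hSS, sub_eq_zero]
        rfl)
      fun g hg => by simp [hg, hBker g hg]
    intro g
    have h' := DFunLike.congr_fun h g
    rwa [sub_apply, zero_apply, sub_eq_zero] at h'
  set w : Ω → Lp ℝ 2 μ := fun x =>
    (InnerProductSpace.toDual ℝ (Lp ℝ 2 μ)).symm (ContinuousMap.evalCLM ℝ x ∘L B) with hw
  have hwB : ∀ x g, inner ℝ (w x) g = B g x := fun x g => by
    rw [hw, InnerProductSpace.toDual_symm_apply]
    rfl
  have hSw : ∀ x, S (w x) = sectionMap L μ x := fun x => by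
    refine ext_inner_right ℝ fun g => ?_
    rw [hS, hwB, hB, pairing_apply]
  have hgram : ∀ x y, inner ℝ (w x) (w y) = L (x, y) := fun x y => by
    have h : B (w y) = L.curry y := by
      apply ContinuousMap.toLp_injective (p := 2) (𝕜 := ℝ) μ
      rw [hBS, hSw]
      rfl
    rw [hwB, h, ContinuousMap.curry_apply, hsymm]
  have hcont : Continuous w := by
    refine continuous_iff_continuousAt.mpr fun x => ?_
    rw [ContinuousAt, tendsto_iff_norm_sub_tendsto_zero]
    have h : ∀ y, ‖w y - w x‖ = Real.sqrt (L (y, y) - 2 * L (y, x) + L (x, x)) := fun y => by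
      rw [← Real.sqrt_sq (norm_nonneg (w y - w x)), norm_sub_sq_real, hgram,
        ← real_inner_self_eq_norm_sq, ← real_inner_self_eq_norm_sq, hgram, hgram]
    simp only [h]
    have hc : Continuous fun y => Real.sqrt (L (y, y) - 2 * L (y, x) + L (x, x)) := by fun_prop
    have h₀ := hc.tendsto x
    rwa [show L (x, x) - 2 * L (x, x) + L (x, x) = 0 by ring, Real.sqrt_zero] at h₀
  refine ⟨⟨w, hcont⟩, hgram, fun f g => ?_⟩
  have hpair : ∀ g, pairing ⟨w, hcont⟩ g = B g := fun g => by
    ext x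
    exact hwB x g
  rw [hpair, hpair, hBS, hBS, hS]

end Feature

/-! ### Jointly measurable and symmetric representatives of `L²`-valued maps -/

section Representative

/-- On a compact space, a continuous map is a uniform limit of simple functions. -/
theorem exists_simpleFunc_edist_le {Ω E : Type*} [TopologicalSpace Ω] [CompactSpace Ω]
    [MeasurableSpace Ω] [BorelSpace Ω] [NormedAddCommGroup E] (w : C(Ω, E)) {ε : ℝ}
    (hε : 0 < ε) : ∃ s : SimpleFunc Ω E, ∀ x, dist (s x) (w x) ≤ ε := by
  borelize E
  obtain ⟨t, -, ht, hcover⟩ := (isCompact_range w.continuous).finite_cover_balls hε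
  set l := ht.toFinset.toList with hl
  set e : ℕ → E := fun n => l.getD n 0 with he
  refine ⟨(SimpleFunc.nearestPt e l.length).comp w w.continuous.measurable, fun x => ?_⟩
  obtain ⟨y, hy, hxy⟩ := Set.mem_iUnion₂.mp (hcover (Set.mem_range_self x))
  have hyl : y ∈ l := by simpa [hl] using hy
  obtain ⟨n, hn, rfl⟩ := List.mem_iff_getElem.mp hyl
  have h := SimpleFunc.edist_nearestPt_le e (w x) hn.le
  have hen : e n = l[n] := by simp [he, hn]
  rw [hen, edist_dist, edist_dist, ENNReal.ofReal_le_ofReal_iff dist_nonneg] at h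
  exact h.trans (by rw [dist_comm]; exact (Metric.mem_ball.mp hxy).le)

/-- Summable `L²` distances imply almost everywhere convergence. -/
theorem ae_tendsto_of_summable_norm_sub {Ω : Type*} [MeasurableSpace Ω] {μ : Measure Ω}
    [IsProbabilityMeasure μ] {f : ℕ → Lp ℝ 2 μ} {g : Lp ℝ 2 μ} {b : ℕ → ℝ} (hb : Summable b)
    (h : ∀ n, dist (f n) g ≤ b n) :
    ∀ᵐ y ∂μ, Filter.Tendsto (fun n => f n y) Filter.atTop (nhds (g y)) := by
  have hle : ∀ n, ∫⁻ y, ‖f n y - g y‖ₑ ∂μ ≤ ENNReal.ofReal (b n) := fun n => by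
    have h₁ : ∫⁻ y, ‖f n y - g y‖ₑ ∂μ = eLpNorm (f n - g : Lp ℝ 2 μ) 1 μ := by
      rw [eLpNorm_one_eq_lintegral_enorm]
      refine lintegral_congr_ae ?_
      filter_upwards [Lp.coeFn_sub (f n) g] with y hy
      rw [hy, Pi.sub_apply]
    rw [h₁]
    refine (eLpNorm_le_eLpNorm_of_exponent_le one_le_two
      (Lp.aestronglyMeasurable _)).trans ?_
    rw [← Lp.enorm_def, ← ofReal_norm, ← dist_eq_norm]
    exact ENNReal.ofReal_le_ofReal (h n)
  have hmeas : ∀ n, AEMeasurable (fun y => ‖f n y - g y‖ₑ) μ := fun n =>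
    ((Lp.aestronglyMeasurable (f n)).sub (Lp.aestronglyMeasurable g)).enorm
  have hsum : ∫⁻ y, ∑' n, ‖f n y - g y‖ₑ ∂μ ≠ ∞ := by
    rw [lintegral_tsum hmeas]
    exact ne_top_of_le_ne_top hb.tsum_ofReal_ne_top (ENNReal.tsum_le_tsum hle)
  filter_upwards [ae_lt_top' (AEMeasurable.tsum hmeas) hsum] with y hy
  rw [tendsto_iff_edist_tendsto_0]
  simp only [edist_eq_enorm_sub]
  exact ENNReal.tendsto_atTop_zero_of_tsum_ne_top hy.ne

variable {Ω : Type*} [TopologicalSpace Ω] [CompactSpace Ω] [MeasurableSpace Ω] [BorelSpace Ω]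
  {μ : Measure Ω} [IsProbabilityMeasure μ]

/-- A continuous map `w` into `L²(μ)` has a jointly measurable representative, which represents
`w x` for every `x`. It is the limit of a sequence of simple maps that converges so fast uniformly
that the representatives converge almost everywhere on every section. -/
theorem exists_measurable_representative (w : C(Ω, Lp ℝ 2 μ)) :
    ∃ k : Ω × Ω → ℝ, Measurable k ∧ ∀ x, ∀ᵐ y ∂μ, k (x, y) = w x y := by
  have hpos : ∀ n : ℕ, (0 : ℝ) < (1 / 2) ^ n := fun n => by positivity
  choose s hs using fun n => exists_simpleFunc_edist_le w (hpos n)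
  have hmeas : ∀ n, Measurable fun p : Ω × Ω => (s n p.1 : Ω → ℝ) p.2 := fun n =>
    SimpleFunc.measurable_bind ((s n).comp Prod.fst measurable_fst)
      (fun (f : Lp ℝ 2 μ) (p : Ω × Ω) => f p.2)
      fun f => (Lp.stronglyMeasurable f).measurable.comp measurable_snd
  refine ⟨fun p => Filter.atTop.limUnder fun n => (s n p.1 : Ω → ℝ) p.2,
    (StronglyMeasurable.limUnder fun n => (hmeas n).stronglyMeasurable).measurable, fun x => ?_⟩
  filter_upwards [ae_tendsto_of_summable_norm_sub summable_geometric_two fun n => hs n x]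
    with y hy
  exact hy.limUnder_eq

theorem integrable_sq_of_ae_eq {w : C(Ω, Lp ℝ 2 μ)} {k : Ω × Ω → ℝ} (hk : Measurable k)
    (hw : ∀ x, ∀ᵐ y ∂μ, k (x, y) = w x y) : Integrable (fun p => k p ^ 2) (μ.prod μ) := by
  have hsec : ∀ x, Integrable (fun y => w x y ^ 2) μ := fun x =>
    (memLp_two_iff_integrable_sq (Lp.aestronglyMeasurable _)).mp (Lp.memLp (w x))
  have hae : ∀ x, (fun y => k (x, y) ^ 2) =ᵐ[μ] fun y => w x y ^ 2 := fun x => by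
    filter_upwards [hw x] with y hy
    rw [hy]
  refine (integrable_prod_iff (hk.pow_const 2).aestronglyMeasurable).mpr
    ⟨.of_forall fun x => (hsec x).congr (hae x).symm, ?_⟩
  have h : ∀ x, ∫ y, ‖k (x, y) ^ 2‖ ∂μ = inner ℝ (w x) (w x) := fun x => by
    rw [L2.inner_def]
    refine integral_congr_ae ?_
    filter_upwards [hw x] with y hy
    rw [hy, Real.norm_of_nonneg (sq_nonneg _), real_inner_self_eq_norm_sq, Real.norm_eq_abs, sq_abs]
  simp only [h]
  exact Continuous.integrable_of_hasCompactSupport (by fun_prop) (.of_compactSpace _)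

omit [TopologicalSpace Ω] [CompactSpace Ω] [BorelSpace Ω] in
/-- Integrable functions on a product are almost everywhere equal if they have the same integrals
over rectangles. -/
theorem ae_eq_of_setIntegral_rectangle_eq {f g : Ω × Ω → ℝ} (hf : Integrable f (μ.prod μ))
    (hg : Integrable g (μ.prod μ))
    (h : ∀ A B : Set Ω, MeasurableSet A → MeasurableSet B →
      ∫ p in A ×ˢ B, f p ∂μ.prod μ = ∫ p in A ×ˢ B, g p ∂μ.prod μ) : f =ᵐ[μ.prod μ] g := by
  refine Integrable.ae_eq_of_forall_setIntegral_eq _ _ hf hg fun s hs _ => ?_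
  induction s, hs using MeasurableSpace.induction_on_inter generateFrom_prod.symm
    isPiSystem_prod with
  | empty => simp
  | basic s hs =>
    obtain ⟨A, hA, B, hB, rfl⟩ := hs
    exact h A B hA hB
  | compl s hs ih =>
    have huniv : ∫ p, f p ∂μ.prod μ = ∫ p, g p ∂μ.prod μ := by
      simpa using h Set.univ Set.univ .univ .univ
    rw [setIntegral_compl hs hf, setIntegral_compl hs hg, huniv, ih (measure_lt_top _ _)]
  | iUnion s hd hs ih =>
    rw [integral_iUnion hs hd hf.integrableOn, integral_iUnion hs hd hg.integrableOn]
    exact tsum_congr fun n => ih n (measure_lt_top _ _)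

/-- A representative of a symmetric operator is symmetric almost everywhere. -/
theorem ae_eq_swap_of_inner_comm {w : C(Ω, Lp ℝ 2 μ)}
    (hsymm : ∀ f g : Lp ℝ 2 μ, inner ℝ (ContinuousMap.toLp 2 μ ℝ (pairing w f)) g =
      inner ℝ f (ContinuousMap.toLp 2 μ ℝ (pairing w g)))
    {k : Ω × Ω → ℝ} (hk : Measurable k) (hw : ∀ x, ∀ᵐ y ∂μ, k (x, y) = w x y) :
    k =ᵐ[μ.prod μ] fun p => k p.swap := by
  have hint : Integrable k (μ.prod μ) :=
    ((memLp_two_iff_integrable_sq hk.aestronglyMeasurable).mpr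
      (integrable_sq_of_ae_eq hk hw)).integrable one_le_two
  -- The matrix coefficient of the operator at two indicator functions.
  have hcoef : ∀ A B : Set Ω, ∀ (hA : MeasurableSet A) (hB : MeasurableSet B),
      inner ℝ (indicatorConstLp 2 hA (measure_ne_top μ A) (1 : ℝ)) (ContinuousMap.toLp 2 μ ℝ
        (pairing w (indicatorConstLp 2 hB (measure_ne_top μ B) (1 : ℝ)))) =
      ∫ p in A ×ˢ B, k p ∂μ.prod μ := fun A B hA hB => by
    rw [L2.inner_indicatorConstLp_one, setIntegral_prod _ hint.integrableOn]
    refine setIntegral_congr_ae hA ?_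
    filter_upwards [ContinuousMap.coeFn_toLp (p := 2) (𝕜 := ℝ) μ
      (pairing w (indicatorConstLp 2 hB (measure_ne_top μ B) (1 : ℝ)))] with x hx _
    rw [hx, pairing_apply, real_inner_comm, L2.inner_indicatorConstLp_one]
    refine setIntegral_congr_ae hB ?_
    filter_upwards [hw x] with y hy _
    exact hy.symm
  refine ae_eq_of_setIntegral_rectangle_eq hint hint.swap fun A B hA hB => ?_
  rw [← hcoef A B hA hB, ← hsymm, real_inner_comm, hcoef B A hB hA]
  exact (setIntegral_prod_swap (μ := μ) (ν := μ) B A k).symm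

open Classical in
/-- If `w` defines a symmetric operator, then its representative can be chosen symmetric without
losing any section: a representative `k` is symmetrized outside of the null set `N` of those `x`
whose row and column differ, and for `x ∈ N` the column is replaced by the row. -/
theorem exists_symmetric_representative {w : C(Ω, Lp ℝ 2 μ)}
    (hsymm : ∀ f g : Lp ℝ 2 μ, inner ℝ (ContinuousMap.toLp 2 μ ℝ (pairing w f)) g =
      inner ℝ f (ContinuousMap.toLp 2 μ ℝ (pairing w g))) :
    ∃ k : Ω → Ω → ℝ, Measurable (Function.uncurry k) ∧ (∀ x y, k x y = k y x) ∧
      ∀ x, ∀ᵐ y ∂μ, k x y = w x y := by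
  obtain ⟨k, hk, hw⟩ := exists_measurable_representative w
  have hks : Measurable fun p : Ω × Ω => k p.swap := hk.comp measurable_swap
  have hD : MeasurableSet {p : Ω × Ω | k p ≠ k p.swap} := (measurableSet_eq_fun hk hks).compl
  set N : Set Ω := {x | μ (Prod.mk x ⁻¹' {p : Ω × Ω | k p ≠ k p.swap}) ≠ 0} with hN
  have hNm : MeasurableSet N :=
    (measurable_measure_prodMk_left hD (measurableSet_singleton 0)).compl
  have hN₀ : ∀ᵐ y ∂μ, y ∉ N := by
    have h := (Measure.measure_prod_null hD).mp (ae_eq_swap_of_inner_comm hsymm hk hw)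
    filter_upwards [h] with y hy hyN
    exact hyN hy
  refine ⟨fun x y => if x ∈ N then (if y ∈ N then 0 else k (x, y)) else
    (if y ∈ N then k (y, x) else (k (x, y) + k (y, x)) / 2), ?_, fun x y => ?_, fun x => ?_⟩
  · have h₁ : MeasurableSet {p : Ω × Ω | p.1 ∈ N} := measurable_fst hNm
    have h₂ : MeasurableSet {p : Ω × Ω | p.2 ∈ N} := measurable_snd hNm
    exact Measurable.ite h₁ (Measurable.ite h₂ measurable_const hk)
      (Measurable.ite h₂ hks ((hk.add hks).div_const 2))
  · by_cases hx : x ∈ N <;> by_cases hy : y ∈ N <;> simp [hx, hy, add_comm]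
  · by_cases hx : x ∈ N
    · filter_upwards [hN₀, hw x] with y hy hxy
      simp [hx, hy, hxy]
    · have hx' : ∀ᵐ y ∂μ, k (x, y) = k (y, x) := not_not.mp hx
      filter_upwards [hN₀, hw x, hx'] with y hy hxy hxy'
      simp [hx, hy, ← hxy', hxy]

end Representative

theorem exists_isConvolutionSqrt {Ω : Type*} [TopologicalSpace Ω] [CompactSpace Ω] [T2Space Ω]
    [MeasurableSpace Ω] [BorelSpace Ω] {μ : Measure Ω} [IsProbabilityMeasure μ] [μ.Regular]
    [μ.IsOpenPosMeasure] {L : Ω → Ω → ℝ} (hL : IsKernel L) (hpos : IsPositiveDefinite L) :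
    ∃ k : Ω → Ω → ℝ, IsConvolutionSqrt μ L k := by
  obtain ⟨w, hgram, hsymm⟩ := exists_feature_map (L := ⟨Function.uncurry L, hL.continuous⟩)
    (μ := μ) hL.symm hpos
  obtain ⟨k, hk, hks, hw⟩ := exists_symmetric_representative hsymm
  have hmul : ∀ x y, (fun z => k x z * k z y) =ᵐ[μ] fun z => inner ℝ (w x z) (w y z) :=
    fun x y => by
      filter_upwards [hw x, hw y] with z hx hy
      rw [hks z y, hx, hy, Real.inner_apply]
  refine ⟨k, hk, ?_, hks, fun x y => ?_, fun x y => ?_⟩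
  · exact (memLp_two_iff_integrable_sq hk.aestronglyMeasurable).mpr (integrable_sq_of_ae_eq hk hw)
  · exact (L2.integrable_inner (w x) (w y)).congr (hmul x y).symm
  · rw [integral_congr_ae (hmul x y), ← L2.inner_def, hgram]
    rfl

end Stolarsky

theorem theorem5p1 {Ω : Type*} [TopologicalSpace Ω] [CompactSpace Ω] [T2Space Ω]
    [MeasurableSpace Ω] [BorelSpace Ω]
    (K : Ω → Ω → ℝ) (hK : Stolarsky.IsKernel K)
    (C : ℝ) (hC : Stolarsky.IsPositiveDefinite (fun x y => K x y + C))
    (μ : Measure Ω) [IsProbabilityMeasure μ] [μ.Regular]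
    (hinv : Stolarsky.IsInvariantMeasure K μ) (hsupp : μ.support = Set.univ) :
    (∃ k : Ω → Ω → ℝ, Stolarsky.IsConvolutionSqrt μ (fun x y => K x y + C) k) ∧
    ∀ k : Ω → Ω → ℝ, Stolarsky.IsConvolutionSqrt μ (fun x y => K x y + C) k →
      (∀ ν : SignedMeasure Ω, Stolarsky.IsRegularSigned ν → ν Set.univ = 1 →
        Stolarsky.L2DiscrepancyWellDefined k μ ν ∧
        Stolarsky.energy K ν - Stolarsky.energy K μ.toSignedMeasure =
          Stolarsky.l2DiscrepancySq k μ ν) ∧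
      (∀ (N : ℕ) (z : Fin N → Ω), 0 < N →
        Integrable (fun x => |Stolarsky.discreteLocalDiscrepancy k μ z x| ^ 2) μ ∧
        Stolarsky.discreteEnergy K z - Stolarsky.energy K μ.toSignedMeasure =
          Stolarsky.discreteL2DiscrepancySq k μ z) := by
  have : μ.IsOpenPosMeasure := ⟨fun U hU ⟨x, hx⟩ =>
    ((μ.mem_support_iff_forall x).mp (hsupp ▸ Set.mem_univ x) U (hU.mem_nhds hx)).ne'⟩
  refine ⟨Stolarsky.exists_isConvolutionSqrt
    ⟨hK.continuous.add continuous_const, fun x y => by rw [hK.symm]⟩ hC, fun k hk => ?_⟩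
  have hbound : ∀ x y, |K x y| ≤ ‖(⟨Function.uncurry K, hK.continuous⟩ : C(Ω × Ω, ℝ))‖ :=
    fun x y => ContinuousMap.norm_coe_le_norm ⟨Function.uncurry K, hK.continuous⟩ (x, y)
  exact ⟨fun ν _ hν =>
      Stolarsky.wellDefined_and_energy_sub_eq_l2DiscrepancySq hk hbound hinv ν hν,
    fun N z hN => Stolarsky.integrable_and_discreteEnergy_sub_eq hk hbound hinv z hN⟩
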